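/- Let $L\ge 1$ and $K=\bigcup_{\ell=1}^L[a_\ell,b_\ell]$ with $-1=a_1<b_1<a_2<b_2<\cdots<a_L<b_L=1$, let $w$ be a continuous and positive function on $K$, and let $N\ge 0$ be an integer. For a real polynomial $P$ put $$\left\|\frac{P}{w}\right\|_{L_1(K)}=\sum_{\ell=1}^L\int_{a_\ell}^{b_\ell}\frac{|P(t)|}{w(t)}\,dt .$$ Write a polynomial of degree at most $N$ as $P=\sum_{n=0}^N p_nT_n$, with $\mathbf p=(p_0,\dots,p_N)$, where $T_n$ and $U_n$ denote the classical Chebyshev polynomials of the first and second kind. For each $\ell$ let $$P_\ell(x)=P\Big(\tfrac{(b_\ell-a_\ell)x+a_\ell+b_\ell}{2}\Big),\qquad w_\ell(x)=w\Big(\tfrac{(b_\ell-a_\ell)x+a_\ell+b_\ell}{2}\Big),\qquad x\in[-1,1],$$ let $\mathbf W^\ell\in\mathbb R^{(N+1)\times(N+1)}$ be the matrix such that $P_\ell=\sum_{n=0}^N(\mathbf W^\ell\mathbf p)_nU_n$ for all such $P$, and, for $d\ge N$, let $\mathbf J^{\ell,d}\in\mathbb R^{(d+1)\times(N+1)}$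 have the entries $$J^{\ell,d}_{k,n}=\int_0^\pi\frac{\cos(k\theta)\sin((n+1)\theta)}{w_\ell(\cos\theta)}\,d\theta,\qquad 0\le k\le d,\ 0\le n\le N .$$ For $\mathbf y=(y_0,\dots,y_d)\in\mathbb R^{d+1}$ let $\mathrm{Toep}_d(\mathbf y)=(y_{|i-j|})_{0\le i,j\le d}$. The ersatz norm of level $d$ of a polynomial $P$ of degree at most $N$ is the optimal value $$/\!\!/P/\!\!/_d=\inf\ \sum_{\ell=1}^L\frac{b_\ell-a_\ell}{2}\big(y^{\ell,+}_0+y^{\ell,-}_0\big)$$ over all $\mathbf y^{1,\pm},\dots,\mathbf y^{L,\pm}\in\mathbb R^{d+1}$ such that, for every $\ell$, $\mathbf y^{\ell,+}-\mathbf y^{\ell,-}=\mathbf J^{\ell,d}\mathbf W^\ell\mathbf p$ and both matrices $\mathrm{Toep}_d(\mathbf y^{\ell,\pm})$ are positive semidefinite. For each $d\ge N$ let $\mathcal V_{N,d}^K$ be any minimizer of $/\!\!/P/\!\!/_d$ over the monic polynomials $P$ of degree $N$. In what follows $\mathcal U_N^K$ stands for a minimizer of $\|P/w\|_{L_1(K)}$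 over the monic polynomials $P$ of degree $N$. Then: 1. The sequence $(\mathcal V_{N,d}^K)_{d\ge N}$ has a subsequence that converges (with respect to any norm on the space of polynomials of degree at most $N$) to a minimizer $\mathcal U_N^K$; in particular such a minimizer exists. 2. The ersatz minima increase to the $L_1$ minimum: for every $d\ge N$ and every minimizer $\mathcal U_N^K$, $$/\!\!/\mathcal V_{N,d}^K/\!\!/_d\ \le\ /\!\!/\mathcal V_{N,d+1}^K/\!\!/_{d+1}\ \le\ \left\|\frac{\mathcal U_N^K}{w}\right\|_{L_1(K)}\qquad\text{and}\qquad\lim_{d\to\infty}/\!\!/\mathcal V_{N,d}^K/\!\!/_d=\left\|\frac{\mathcal U_N^K}{w}\right\|_{L_1(K)} .$$ 3. If the minimizer $\mathcal U_N^K$ is unique, then the whole sequence $(\mathcal V_{N,d}^K)_{d\ge N}$ converges to $\mathcal U_N^K$ (with respect to any norm on the space of polynomials of degree at most $N$). -/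

import Mathlib

open Filter Topology Polynomial

noncomputable section

namespace ErsatzChebyshev

/-- A disjoint union of `L ≥ 1` nondegenerate compact intervals
`[a 0, b 0], …, [a (L-1), b (L-1)]` listed from left to right, the first one starting at `-1` and
the last one ending at `1`. -/
structure IntervalUnion (L : ℕ) where
  a : Fin L → ℝ
  b : Fin L → ℝ
  pos : 0 < L
  lt : ∀ l, a l < b l
  sep : ∀ l l', l < l' → b l < a l'
  first : a ⟨0, pos⟩ = -1
  last : b ⟨L - 1, Nat.sub_lt pos one_pos⟩ = 1

variable {L : ℕ}

/-- The set `K = ⋃ₗ [aₗ, bₗ]`. -/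
def IntervalUnion.carrier (K : IntervalUnion L) : Set ℝ := ⋃ l, Set.Icc (K.a l) (K.b l)

/-- The affine polynomial `((bₗ - aₗ) X + aₗ + bₗ) / 2`, which maps `[-1, 1]` onto `[aₗ, bₗ]`. -/
def IntervalUnion.affine (K : IntervalUnion L) (l : Fin L) : ℝ[X] :=
  C ((K.b l - K.a l) / 2) * X + C ((K.a l + K.b l) / 2)

/-- The function `w` restricted to `[aₗ, bₗ]` and transplanted to `[-1, 1]`. -/
def transplant (K : IntervalUnion L) (w : ℝ → ℝ) (l : Fin L) (x : ℝ) : ℝ :=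
  w (((K.b l - K.a l) * x + K.a l + K.b l) / 2)

/-- The weighted norm `‖P / w‖` in `L₁(K)`. -/
def l1Norm (K : IntervalUnion L) (w : ℝ → ℝ) (P : ℝ[X]) : ℝ :=
  ∑ l, ∫ t in (K.a l)..(K.b l), |P.eval t| / w t

/-- The Chebyshev polynomials of the second kind, as a sequence of polynomials of degree `n`. -/
def chebyshevUSequence : Polynomial.Sequence ℝ where
  elems' n := Chebyshev.U ℝ n
  degree_eq' n := Chebyshev.degree_U_natCast ℝ n

/-- The basis `T₀, T₁, …` of the space of real polynomials. -/
def basisT : Module.Basis ℕ ℝ ℝ[X] :=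
  (Chebyshev.chebyshevTsequence ℝ).basis fun i =>
    isUnit_iff_ne_zero.2 (leadingCoeff_ne_zero.2 ((Chebyshev.chebyshevTsequence ℝ).ne_zero i))

/-- The basis `U₀, U₁, …` of the space of real polynomials. -/
def basisU : Module.Basis ℕ ℝ ℝ[X] :=
  chebyshevUSequence.basis fun i =>
    isUnit_iff_ne_zero.2 (leadingCoeff_ne_zero.2 (chebyshevUSequence.ne_zero i))

/-- The vector `(p₀, …, p_N)` of Chebyshev coefficients, `P = ∑ₙ pₙ Tₙ` when `deg P ≤ N`. -/
def chebCoeffs (N : ℕ) (P : ℝ[X]) : Fin (N + 1) → ℝ := fun n => basisT.repr P n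

/-- The matrix `Wˡ` of the linear map taking the Chebyshev coefficients of a polynomial `P` of
degree at most `N` to the coefficients of `Pₗ` in the basis `U₀, …, U_N`, where `Pₗ` is `P`
transplanted from `[aₗ, bₗ]` to `[-1, 1]`. -/
def matW (K : IntervalUnion L) (N : ℕ) (l : Fin L) : Matrix (Fin (N + 1)) (Fin (N + 1)) ℝ :=
  Matrix.of fun n m => basisU.repr ((Chebyshev.T ℝ (m : ℕ)).comp (K.affine l)) n

/-- The matrix `Jˡᵈ` with rows `k = 0, …, d` and columns `n = 0, …, N`. -/
def matJ (K : IntervalUnion L) (w : ℝ → ℝ) (N d : ℕ) (l : Fin L) :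
    Matrix (Fin (d + 1)) (Fin (N + 1)) ℝ :=
  Matrix.of fun k n => ∫ θ in (0 : ℝ)..Real.pi,
    Real.cos ((k : ℕ) * θ) * Real.sin (((n : ℕ) + 1) * θ) / transplant K w l (Real.cos θ)

/-- The symmetric Toeplitz matrix with entries `y_{|i - j|}`. -/
def toeplitz {d : ℕ} (y : Fin (d + 1) → ℝ) : Matrix (Fin (d + 1)) (Fin (d + 1)) ℝ :=
  Matrix.of fun i j => y ⟨((i : ℕ) - j) + ((j : ℕ) - i), by omega⟩

/-- The constraints of the semidefinite program of level `d` attached to `P`; the variables are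
`yp l = y^{ℓ,+}` and `ym l = y^{ℓ,-}`. -/
structure Feasible (K : IntervalUnion L) (w : ℝ → ℝ) (N d : ℕ) (P : ℝ[X])
    (yp ym : Fin L → Fin (d + 1) → ℝ) : Prop where
  moments : ∀ l, yp l - ym l = (matJ K w N d l).mulVec ((matW K N l).mulVec (chebCoeffs N P))
  psd_pos : ∀ l, (toeplitz (yp l)).PosSemidef
  psd_neg : ∀ l, (toeplitz (ym l)).PosSemidef

/-- The objective function of the semidefinite program. -/
def objective (K : IntervalUnion L) {d : ℕ} (yp ym : Fin L → Fin (d + 1) → ℝ) : ℝ :=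
  ∑ l, (K.b l - K.a l) / 2 * (yp l 0 + ym l 0)

/-- The ersatz norm of level `d` of a polynomial `P` of degree at most `N`: the optimal value of
the semidefinite program. -/
def ersatzNorm (K : IntervalUnion L) (w : ℝ → ℝ) (N d : ℕ) (P : ℝ[X]) : ℝ :=
  sInf {v | ∃ yp ym : Fin L → Fin (d + 1) → ℝ, Feasible K w N d P yp ym ∧ v = objective K yp ym}

/-- `P` minimizes `F` among the monic polynomials of degree `N`. -/
def IsMonicMinimizer (N : ℕ) (F : ℝ[X] → ℝ) (P : ℝ[X]) : Prop :=
  (P.Monic ∧ P.natDegree = N) ∧ ∀ Q : ℝ[X], Q.Monic → Q.natDegree = N → F P ≤ F Q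

/-- Convergence in the space of polynomials of degree at most `N`, with respect to every norm on
that space. -/
def ConvergesTo {N : ℕ} (V : ℕ → degreeLE ℝ N) (U : degreeLE ℝ N) : Prop :=
  ∀ ν : Seminorm ℝ (degreeLE ℝ N), (∀ P, ν P = 0 → P = 0) →
    Tendsto (fun m => ν (V m - U)) atTop (𝓝 0)

end ErsatzChebyshev

end

/-! On each interval put `h = P_ℓ / w_ℓ`. Since `sin ((n+1)θ) = U_n(cos θ) sin θ`, the substitution
`x = cos θ` turns the affine constraint into: `y⁺ - y⁻` is the vector of moments `∫ T_k h dx`, `k ≤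
d`. The program is thus a truncated moment relaxation of the minimal total mass of a decomposition
of `h dx` into two positive measures. The parts `h⁺` and `h⁻` are feasible with value the L₁ norm
(`exists_feasible`), and truncating a feasible point of level `d + 1` gives one of level `d`. Hence
the ersatz norms increase with `d` and stay below the L₁ norm. They converge to it by duality
(`eventually_le_of_moments`): test `h` against a polynomial close to its sign, and use that a
positive semidefinite Toeplitz matrix has nonnegative Fejér means (`fejer_nonneg`), so that pairing
`y` with a polynomial bounded by `M` costs at most `M * y 0`, up to the damping factors `1 -
k/(d+1)`, which tend to 1. In finite dimension Dini's theorem makes this convergence uniform on the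
unit sphere: for every `r < 1`, eventually `r‖x‖ ≤ E d x ≤ ‖x‖` for all `x`. Compactness and
convergence of the minimizers follow from these bounds. -/

noncomputable section

namespace ErsatzChebyshev

/-! ### Minimizers of functionals increasing to a norm -/

section Approximation

variable {X : Type*} [NormedAddCommGroup X] [NormedSpace ℝ X]

/-- An increasing family of nonnegative sublinear functionals that approximates a norm from
below. -/
structure ApproximatesNorm (E : ℕ → X → ℝ) : Prop where
  nonneg : ∀ d x, 0 ≤ E d x
  add_le : ∀ d x y, E d (x + y) ≤ E d x + E d y
  smul_le : ∀ d (c : ℝ) x, 0 < c → E d (c • x) ≤ c * E d x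
  le_norm : ∀ d x, E d x ≤ ‖x‖
  mono : ∀ x, Monotone fun d => E d x
  tendsto : ∀ x, Tendsto (fun d => E d x) atTop (𝓝 ‖x‖)

variable {E : ℕ → X → ℝ}

theorem ApproximatesNorm.continuous (hE : ApproximatesNorm E) (d : ℕ) : Continuous (E d) := by
  have key : ∀ x y, E d x - E d y ≤ ‖x - y‖ := fun x y => by
    have h := hE.add_le d (x - y) y
    rw [sub_add_cancel] at h
    linarith [hE.le_norm d (x - y)]
  have : LipschitzWith 1 (E d) := LipschitzWith.of_dist_le_mul fun x y => by
    rw [Real.dist_eq, dist_eq_norm, NNReal.coe_one, one_mul, abs_sub_le_iff]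
    exact ⟨key x y, norm_sub_rev x y ▸ key y x⟩
  exact this.continuous

variable {A : Set X} {N : ℕ} {V : ℕ → X}

theorem ApproximatesNorm.le_succ (hE : ApproximatesNorm E)
    (hV : ∀ d, N ≤ d → V d ∈ A ∧ ∀ Q ∈ A, E d (V d) ≤ E d Q) {d : ℕ} (hd : N ≤ d) :
    E d (V d) ≤ E (d + 1) (V (d + 1)) :=
  ((hV d hd).2 _ (hV (d + 1) (by omega)).1).trans (hE.mono _ d.le_succ)

variable [FiniteDimensional ℝ X]

/-- The approximation is uniform, by Dini's theorem on the unit sphere. -/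
theorem ApproximatesNorm.eventually_le (hE : ApproximatesNorm E) {r : ℝ} (hr : r < 1) :
    ∀ᶠ d in atTop, ∀ x, r * ‖x‖ ≤ E d x := by
  have : ProperSpace X := FiniteDimensional.proper ℝ X
  have h := Monotone.tendstoUniformlyOn_of_forall_tendsto (isCompact_sphere (0 : X) 1)
    (fun d => (hE.continuous d).continuousOn) (fun x _ => hE.mono x) continuous_norm.continuousOn
    (fun x _ => hE.tendsto x)
  filter_upwards [Metric.tendstoUniformlyOn_iff.1 h (1 - r) (by linarith)] with d hd x
  rcases eq_or_ne x 0 with rfl | hx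
  · simpa using hE.nonneg d 0
  have hx' : 0 < ‖x‖ := norm_pos_iff.2 hx
  have hn : ‖‖x‖⁻¹ • x‖ = 1 := by
    rw [norm_smul, norm_inv, norm_norm, inv_mul_cancel₀ hx'.ne']
  -- Positive homogeneity carries the bound from the sphere to `x`; only the inequality in `smul_le`
  -- is needed.
  have h1 := hd (‖x‖⁻¹ • x) (by simp [hn])
  rw [Real.dist_eq, hn] at h1
  have h2 := (abs_lt.1 h1).2
  have h3 := hE.smul_le d ‖x‖⁻¹ x (inv_pos.2 hx')
  have h4 : r ≤ ‖x‖⁻¹ * E d x := by linarith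
  rwa [inv_mul_eq_div, le_div_iff₀ hx'] at h4

/-- Working along an arbitrary `ψ → ∞` lets the same compactness argument give convergence of the
whole sequence under uniqueness. -/
theorem ApproximatesNorm.exists_subseq_tendsto (hE : ApproximatesNorm E) (hA : IsClosed A)
    (hV : ∀ d, N ≤ d → V d ∈ A ∧ ∀ Q ∈ A, E d (V d) ≤ E d Q) {ψ : ℕ → ℕ}
    (hψ : Tendsto ψ atTop atTop) :
    ∃ U ∈ A, (∀ Q ∈ A, ‖U‖ ≤ ‖Q‖) ∧
      ∃ φ : ℕ → ℕ, StrictMono φ ∧ Tendsto (V ∘ ψ ∘ φ) atTop (𝓝 U) := by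
  have : ProperSpace X := FiniteDimensional.proper ℝ X
  -- With `r = 1/2`: `‖V d‖ / 2 ≤ E d (V d) ≤ E d (V N) ≤ ‖V N‖`.
  have hb : ∀ᶠ m in atTop, (V ∘ ψ) m ∈ Metric.closedBall (0 : X) (2 * ‖V N‖) := by
    filter_upwards [hψ.eventually (hE.eventually_le (r := 1 / 2) (by norm_num)),
      hψ.eventually (eventually_ge_atTop N)] with m hm hN
    have h1 := hm (V (ψ m))
    have h2 := (hV _ hN).2 (V N) (hV N le_rfl).1
    have h3 := hE.le_norm (ψ m) (V N)
    simp only [mem_closedBall_zero_iff, Function.comp_apply]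
    linarith
  obtain ⟨U, -, φ, hφ, hU⟩ :=
    tendsto_subseq_of_frequently_bounded Metric.isBounded_closedBall hb.frequently
  have hψφ : Tendsto (ψ ∘ φ) atTop atTop := hψ.comp hφ.tendsto_atTop
  refine ⟨U, hA.mem_of_tendsto hU ?_, fun Q hQ => ?_, φ, hφ, hU⟩
  · filter_upwards [hψφ.eventually (eventually_ge_atTop N)] with m hm using (hV _ hm).1
  -- Pass to the limit in `r‖V d‖ ≤ E d (V d) ≤ E d Q ≤ ‖Q‖`, then let `r` tend to 1.
  · have hr : ∀ r < (1 : ℝ), r * ‖U‖ ≤ ‖Q‖ := fun r hr => by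
      refine le_of_tendsto (hU.norm.const_mul r) ?_
      filter_upwards [hψφ.eventually (hE.eventually_le hr),
        hψφ.eventually (eventually_ge_atTop N)] with m hm hN
      exact (hm _).trans (((hV _ hN).2 Q hQ).trans (hE.le_norm _ Q))
    have : Tendsto (fun r : ℝ => r * ‖U‖) (𝓝[<] 1) (𝓝 (1 * ‖U‖)) :=
      (tendsto_id.mul_const _).mono_left nhdsWithin_le_nhds
    rw [one_mul] at this
    exact le_of_tendsto this (eventually_nhdsWithin_of_forall fun r h => hr r h)

theorem ApproximatesNorm.tendsto_min (hE : ApproximatesNorm E)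
    (hV : ∀ d, N ≤ d → V d ∈ A ∧ ∀ Q ∈ A, E d (V d) ≤ E d Q) {U : X} (hU : U ∈ A)
    (hmin : ∀ Q ∈ A, ‖U‖ ≤ ‖Q‖) : Tendsto (fun d => E d (V d)) atTop (𝓝 ‖U‖) := by
  refine tendsto_order.2 ⟨fun a ha => ?_, fun a ha => ?_⟩
  · obtain ⟨r, hr, har⟩ : ∃ r < (1 : ℝ), a < r * ‖U‖ ∧ 0 < r := by
      have : Tendsto (fun r : ℝ => r * ‖U‖) (𝓝[<] 1) (𝓝 (1 * ‖U‖)) :=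
        (tendsto_id.mul_const _).mono_left nhdsWithin_le_nhds
      rw [one_mul] at this
      have h0 : ∀ᶠ r : ℝ in 𝓝[<] 1, 0 < r :=
        nhdsWithin_le_nhds (eventually_gt_nhds one_pos)
      obtain ⟨r, ⟨h1, h2⟩, h3⟩ :=
        (((this.eventually (eventually_gt_nhds ha)).and h0).and self_mem_nhdsWithin).exists
      exact ⟨r, h3, h1, h2⟩
    filter_upwards [hE.eventually_le hr, eventually_ge_atTop N] with d hd hN
    exact har.1.trans_le ((mul_le_mul_of_nonneg_left (hmin _ (hV d hN).1) har.2.le).trans (hd _))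
  · filter_upwards [eventually_ge_atTop N] with d hN
    exact (((hV d hN).2 U hU).trans (hE.le_norm d U)).trans_lt ha

theorem ApproximatesNorm.tendsto_of_unique (hE : ApproximatesNorm E) (hA : IsClosed A)
    (hV : ∀ d, N ≤ d → V d ∈ A ∧ ∀ Q ∈ A, E d (V d) ≤ E d Q) {U : X}
    (huniq : ∀ U' ∈ A, (∀ Q ∈ A, ‖U'‖ ≤ ‖Q‖) → U' = U) : Tendsto V atTop (𝓝 U) := by
  refine tendsto_of_subseq_tendsto fun ψ hψ => ?_
  obtain ⟨U', h1, h2, φ, -, h3⟩ := hE.exists_subseq_tendsto hA hV hψ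
  exact ⟨φ, huniq U' h1 h2 ▸ h3⟩

end Approximation

/-- A seminorm on a finite-dimensional space is continuous. -/
theorem tendsto_seminorm_sub {X ι : Type*} [NormedAddCommGroup X] [NormedSpace ℝ X]
    [FiniteDimensional ℝ X] (ν : Seminorm ℝ X) {l : Filter ι} {V : ι → X} {U : X}
    (h : Tendsto V l (𝓝 U)) : Tendsto (fun m => ν (V m - U)) l (𝓝 0) := by
  have hc : Continuous ν := by
    rw [← continuousOn_univ]
    exact ν.convexOn.continuousOn isOpen_univ
  have := (hc.tendsto 0).comp (tendsto_sub_nhds_zero_iff.2 h)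
  rwa [map_zero] at this

/-! ### Positive semidefinite Toeplitz matrices and Fejér means -/

open Chebyshev Finset in
/-- A sum over a square of a function of `|i - j|`. -/
theorem sum_range_sum_range_dist (b : ℕ → ℝ) (n : ℕ) :
    ∑ i ∈ range n, ∑ j ∈ range n, b ((i - j) + (j - i)) =
      ∑ k ∈ range n, (if k = 0 then 1 else 2) * ((n : ℝ) - k) * b k := by
  induction n with
  | zero => simp
  | succ n ih =>
    have h1 : ∑ i ∈ range n, b ((i - n) + (n - i)) = ∑ k ∈ range n, b (k + 1) := by
      rw [← sum_range_reflect]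
      refine sum_congr rfl fun k hk => ?_
      rw [mem_range] at hk
      congr 1
      omega
    have h2 : ∑ j ∈ range n, b ((n - j) + (j - n)) = ∑ k ∈ range n, b (k + 1) := by
      rw [← h1]
      exact sum_congr rfl fun k _ => by rw [add_comm]
    have h3 : ∑ k ∈ range (n + 1), (if k = 0 then 1 else 2) * b k =
        2 * ∑ k ∈ range n, b (k + 1) + b 0 := by
      rw [sum_range_succ', mul_sum]
      simp
    have h4 : ∑ k ∈ range (n + 1), (if k = 0 then 1 else 2) * (((n + 1 : ℕ) : ℝ) - k) * b k =
        ∑ k ∈ range (n + 1), (if k = 0 then 1 else 2) * ((n : ℝ) - k) * b k +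
        ∑ k ∈ range (n + 1), (if k = 0 then 1 else 2) * b k := by
      rw [← sum_add_distrib]
      refine sum_congr rfl fun k _ => ?_
      push_cast
      ring
    -- The term `k = n` split off here has weight `n - n = 0`.
    rw [h4, h3, sum_range_succ (fun k => (if k = 0 then 1 else 2) * ((n : ℝ) - k) * b k) n, ← ih,
      sum_range_succ]
    simp only [sum_range_succ, sum_add_distrib, h1, h2]
    simp
    ring

theorem eval_T_dist_cos (i j : ℕ) (θ : ℝ) :
    (Chebyshev.T ℝ ((i - j + (j - i) : ℕ) : ℤ)).eval (Real.cos θ) =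
      Real.cos (i * θ) * Real.cos (j * θ) + Real.sin (i * θ) * Real.sin (j * θ) := by
  rw [Chebyshev.T_real_cos, ← Real.cos_sub, ← sub_mul]
  rcases le_total i j with h | h
  · rw [Nat.sub_eq_zero_of_le h, zero_add, Int.cast_natCast, Nat.cast_sub h, ← Real.cos_neg]
    congr 1
    ring
  · rw [Nat.sub_eq_zero_of_le h, add_zero, Int.cast_natCast, Nat.cast_sub h]

/-- The quadratic form of a Toeplitz matrix. -/
theorem toeplitz_posSemidef_iff {d : ℕ} (y : Fin (d + 1) → ℝ) :
    (toeplitz y).PosSemidef ↔ ∀ v : Fin (d + 1) → ℝ,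
      0 ≤ ∑ i, ∑ j, v i * v j * y ⟨((i : ℕ) - j) + ((j : ℕ) - i), by omega⟩ := by
  have hH : (toeplitz y).IsHermitian := by
    ext i j
    simp [toeplitz, add_comm]
  have hq : ∀ v : Fin (d + 1) → ℝ, star v ⬝ᵥ (toeplitz y).mulVec v =
      ∑ i, ∑ j, v i * v j * y ⟨((i : ℕ) - j) + ((j : ℕ) - i), by omega⟩ := fun v => by
    simp only [dotProduct, Matrix.mulVec, toeplitz, Matrix.of_apply, Finset.mul_sum, Pi.star_apply,
      star_trivial]
    exact Finset.sum_congr rfl fun i _ => Finset.sum_congr rfl fun j _ => by ring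
  simp only [← hq]
  exact ⟨fun h v => h.dotProduct_mulVec_nonneg v, fun h => .of_dotProduct_mulVec_nonneg hH h⟩

/-- The Fejér mean of the measure with cosine moments `y`, as a function of `x = cos θ`. -/
def fejer {d : ℕ} (y : Fin (d + 1) → ℝ) (x : ℝ) : ℝ :=
  ∑ k : Fin (d + 1), (if (k : ℕ) = 0 then 1 else 2) * (1 - (k : ℕ) / (d + 1)) * y k *
    (Chebyshev.T ℝ (k : ℕ)).eval x

/-- Up to the factor `d + 1`, the Fejér mean at `cos θ` is the Hermitian form of the Toeplitz matrix
at `(e^{ikθ})`, that is, the sum of its values at the real vectors `(cos kθ)` and `(sin kθ)`. -/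
theorem fejer_nonneg {d : ℕ} {y : Fin (d + 1) → ℝ} (hy : (toeplitz y).PosSemidef) {x : ℝ}
    (hx : x ∈ Set.Icc (-1 : ℝ) 1) : 0 ≤ fejer y x := by
  obtain ⟨θ, rfl⟩ : ∃ θ, Real.cos θ = x := ⟨Real.arccos x, Real.cos_arccos hx.1 hx.2⟩
  rw [toeplitz_posSemidef_iff] at hy
  -- Extension by zero makes the diagonal-counting identity over `ℕ` applicable; only indices `k ≤
  -- d` occur in it.
  set b : ℕ → ℝ := fun k => (if h : k < d + 1 then y ⟨k, h⟩ else 0) *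
    (Chebyshev.T ℝ (k : ℕ)).eval (Real.cos θ) with hb
  have hd : (0 : ℝ) < d + 1 := by positivity
  have h1 : (d + 1) * fejer y (Real.cos θ) =
      ∑ i : Fin (d + 1), ∑ j : Fin (d + 1), b (((i : ℕ) - j) + ((j : ℕ) - i)) := by
    have := sum_range_sum_range_dist b (d + 1)
    simp only [Finset.sum_range] at this
    rw [this, fejer, Finset.mul_sum]
    refine Finset.sum_congr rfl fun k _ => ?_
    simp only [hb, k.2, dif_pos, Fin.eta]
    push_cast
    field_simp
  have h2 : ∑ i : Fin (d + 1), ∑ j : Fin (d + 1), b (((i : ℕ) - j) + ((j : ℕ) - i)) =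
      ∑ i : Fin (d + 1), ∑ j : Fin (d + 1), Real.cos ((i : ℕ) * θ) * Real.cos ((j : ℕ) * θ) *
          y ⟨((i : ℕ) - j) + ((j : ℕ) - i), by omega⟩ +
      ∑ i : Fin (d + 1), ∑ j : Fin (d + 1), Real.sin ((i : ℕ) * θ) * Real.sin ((j : ℕ) * θ) *
          y ⟨((i : ℕ) - j) + ((j : ℕ) - i), by omega⟩ := by
    simp only [← Finset.sum_add_distrib]
    refine Finset.sum_congr rfl fun i _ => Finset.sum_congr rfl fun j _ => ?_
    have hlt : ((i : ℕ) - j) + ((j : ℕ) - i) < d + 1 := by omega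
    simp only [hb, hlt, dif_pos, eval_T_dist_cos]
    ring
  have h3 : 0 ≤ (d + 1) * fejer y (Real.cos θ) := by
    rw [h1, h2]
    exact add_nonneg (hy _) (hy _)
  exact nonneg_of_mul_nonneg_right h3 hd

-- Orthogonality leaves one term; the factor 2 for `k ≠ 0` compensates for `∫ T_k² = π/2` against
-- `π` for `k = 0`.
open Chebyshev in
theorem integral_fejer_mul_T {d : ℕ} (y : Fin (d + 1) → ℝ) (k : Fin (d + 1)) :
    ∫ x, fejer y x * (T ℝ (k : ℕ)).eval x ∂measureT =
      Real.pi * ((1 - (k : ℕ) / (d + 1)) * y k) := by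
  simp only [fejer, Finset.sum_mul]
  rw [MeasureTheory.integral_finsetSum _ fun i _ => integrable_measureT (by fun_prop),
    Finset.sum_eq_single k]
  · simp only [mul_assoc, MeasureTheory.integral_const_mul]
    by_cases hk : (k : ℕ) = 0
    · have := integral_eval_T_real_mul_self_measureT_zero
      simp only [hk, Nat.cast_zero, this, if_pos]
      ring
    · rw [integral_T_real_mul_self_measureT_of_ne_zero hk, if_neg hk]
      ring
  · intro i _ hi
    simp only [mul_assoc, MeasureTheory.integral_const_mul]
    rw [integral_eval_T_real_mul_eval_T_real_measureT_of_ne fun h => hi (Fin.ext h)]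
    simp
  · simp

-- The Fejér mean is a nonnegative density of mass `π * y 0` for `measureT`; integrating against it
-- a polynomial bounded by `M` gives the estimate.
open Chebyshev MeasureTheory in
theorem abs_sum_mul_le_of_posSemidef {d : ℕ} {y : Fin (d + 1) → ℝ} (hy : (toeplitz y).PosSemidef)
    (c : Fin (d + 1) → ℝ) {M : ℝ}
    (hM : ∀ x ∈ Set.Icc (-1 : ℝ) 1, |∑ k, c k * (T ℝ (k : ℕ)).eval x| ≤ M) :
    |∑ k, c k * ((1 - (k : ℕ) / (d + 1)) * y k)| ≤ M * y 0 := by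
  have hfc : Continuous (fejer y) := by unfold fejer; fun_prop
  have h0 : ∫ x, fejer y x ∂measureT = Real.pi * y 0 := by
    have := integral_fejer_mul_T y 0
    simpa using this
  have h1 : ∫ x, fejer y x * ∑ k, c k * (T ℝ (k : ℕ)).eval x ∂measureT =
      Real.pi * ∑ k, c k * ((1 - (k : ℕ) / (d + 1)) * y k) := by
    simp only [Finset.mul_sum]
    rw [integral_finsetSum _ fun i _ => integrable_measureT (by fun_prop)]
    refine Finset.sum_congr rfl fun k _ => ?_
    simp only [mul_left_comm _ (c k), integral_const_mul, integral_fejer_mul_T]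
  have hae : ∀ᵐ x ∂measureT, x ∈ Set.Icc (-1 : ℝ) 1 := by
    rw [measureT]
    filter_upwards [ae_restrict_mem measurableSet_Ioc] with x hx using Set.Ioc_subset_Icc_self hx
  have h2 : |∫ x, fejer y x * ∑ k, c k * (T ℝ (k : ℕ)).eval x ∂measureT| ≤
      ∫ x, fejer y x * M ∂measureT := by
    rw [← Real.norm_eq_abs]
    refine norm_integral_le_of_norm_le (integrable_measureT (by fun_prop)) ?_
    filter_upwards [hae] with x hx
    rw [norm_mul, Real.norm_of_nonneg (fejer_nonneg hy hx)]
    exact mul_le_mul_of_nonneg_left (hM x hx) (fejer_nonneg hy hx)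
  rw [h1, integral_mul_const, h0, abs_mul, abs_of_pos Real.pi_pos, mul_assoc, mul_comm (y 0)] at h2
  exact le_of_mul_le_mul_left h2 Real.pi_pos

/-! ### Chebyshev expansions and the moments encoded by the matrices -/

variable {L : ℕ}

theorem sequence_repr_sum {M : Type*} [AddCommMonoid M] (S : Polynomial.Sequence ℝ)
    (hS : ∀ i, IsUnit (S i).leadingCoeff) {N : ℕ} {P : ℝ[X]} (hP : P ∈ degreeLE ℝ N)
    {f : ℕ → ℝ → M} (hf : ∀ i, f i 0 = 0) :
    ((S.basis hS).repr P).sum f = ∑ n : Fin (N + 1), f n ((S.basis hS).repr P n) := by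
  have h1 : P ∈ Submodule.span ℝ (S.basis hS '' Set.Iic N) := by
    have : (S.basis hS : ℕ → ℝ[X]) = S := funext fun i => S.basis_eq_self hS i
    rw [this, S.span_degreeLE fun i _ => hS i]
    exact hP
  rw [(S.basis hS).mem_span_image] at h1
  rw [Finsupp.sum_of_support_subset _ (s := Finset.range (N + 1)) _ _ fun i _ => hf i,
    Finset.sum_range]
  intro i hi
  exact Finset.mem_range.2 (Nat.lt_succ_of_le (h1 hi))

theorem sequence_eq_sum_repr (S : Polynomial.Sequence ℝ) (hS : ∀ i, IsUnit (S i).leadingCoeff)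
    {N : ℕ} {P : ℝ[X]} (hP : P ∈ degreeLE ℝ N) :
    P = ∑ n : Fin (N + 1), (S.basis hS).repr P n • S n := by
  conv_lhs => rw [← (S.basis hS).linearCombination_repr P, Finsupp.linearCombination_apply]
  rw [sequence_repr_sum S hS hP (f := fun i a => a • S.basis hS i) fun i => zero_smul ℝ _]
  simp only [S.basis_eq_self]

theorem eq_sum_basisT {N : ℕ} {P : ℝ[X]} (hP : P ∈ degreeLE ℝ N) :
    P = ∑ n : Fin (N + 1), basisT.repr P n • Chebyshev.T ℝ (n : ℕ) :=
  sequence_eq_sum_repr (Chebyshev.chebyshevTsequence ℝ) _ hP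

theorem eq_sum_basisU {N : ℕ} {P : ℝ[X]} (hP : P ∈ degreeLE ℝ N) :
    P = ∑ n : Fin (N + 1), basisU.repr P n • Chebyshev.U ℝ (n : ℕ) :=
  sequence_eq_sum_repr chebyshevUSequence _ hP

theorem IntervalUnion.comp_affine_mem (K : IntervalUnion L) (l : Fin L) {N : ℕ} {P : ℝ[X]}
    (hP : P ∈ degreeLE ℝ N) : P.comp (K.affine l) ∈ degreeLE ℝ N := by
  rw [mem_degreeLE, ← natDegree_le_iff_degree_le] at hP ⊢
  refine natDegree_comp_le.trans ?_
  have : (K.affine l).natDegree ≤ 1 := natDegree_linear_le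
  nlinarith

theorem matW_mulVec (K : IntervalUnion L) (l : Fin L) {N : ℕ} {P : ℝ[X]}
    (hP : P ∈ degreeLE ℝ N) (n : Fin (N + 1)) :
    (matW K N l).mulVec (chebCoeffs N P) n = basisU.repr (P.comp (K.affine l)) n := by
  conv_rhs => rw [eq_sum_basisT hP]
  simp only [Matrix.mulVec, dotProduct, matW, Matrix.of_apply, chebCoeffs, ← coe_compRingHom_apply,
    map_sum]
  simp only [coe_compRingHom_apply, smul_comp, map_smul, Finsupp.coe_finsetSum, Finset.sum_apply,
    Finsupp.smul_apply, smul_eq_mul, mul_comm]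

/-- The polynomial `P` divided by the weight, transplanted from `[aₗ, bₗ]` to `[-1, 1]`. -/
def quotient (K : IntervalUnion L) (w : ℝ → ℝ) (P : ℝ[X]) (l : Fin L) (x : ℝ) : ℝ :=
  (P.comp (K.affine l)).eval x / transplant K w l x

/-- The Chebyshev moments of `g` on `[-1, 1]`. -/
def moment (g : ℝ → ℝ) (k : ℕ) : ℝ := ∫ x in (-1 : ℝ)..1, (Chebyshev.T ℝ k).eval x * g x

section Weight

variable {K : IntervalUnion L} {w : ℝ → ℝ}

theorem IntervalUnion.mapsTo (K : IntervalUnion L) (l : Fin L) {x : ℝ}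
    (hx : x ∈ Set.Icc (-1 : ℝ) 1) : ((K.b l - K.a l) * x + K.a l + K.b l) / 2 ∈ K.carrier := by
  have := K.lt l
  refine Set.mem_iUnion.2 ⟨l, ?_, ?_⟩ <;> nlinarith [hx.1, hx.2]

theorem transplant_pos (hw_pos : ∀ x ∈ K.carrier, 0 < w x) (l : Fin L) {x : ℝ}
    (hx : x ∈ Set.Icc (-1 : ℝ) 1) : 0 < transplant K w l x := hw_pos _ (K.mapsTo l hx)

theorem continuousOn_transplant (hw : ContinuousOn w K.carrier) (l : Fin L) :
    ContinuousOn (transplant K w l) (Set.Icc (-1) 1) :=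
  hw.comp (by fun_prop) fun _ hx => K.mapsTo l hx

theorem continuousOn_eval_div (hw : ContinuousOn w K.carrier)
    (hw_pos : ∀ x ∈ K.carrier, 0 < w x) (l : Fin L) (Q : ℝ[X]) :
    ContinuousOn (fun x => Q.eval x / transplant K w l x) (Set.Icc (-1) 1) :=
  Q.continuous.continuousOn.div (continuousOn_transplant hw l)
    fun _ hx => (transplant_pos hw_pos l hx).ne'

theorem intervalIntegrable_of_continuousOn {g : ℝ → ℝ} (hg : ContinuousOn g (Set.Icc (-1) 1)) :
    IntervalIntegrable g MeasureTheory.volume (-1) 1 :=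
  ContinuousOn.intervalIntegrable_of_Icc (by norm_num) hg

theorem continuousOn_eval_mul {g : ℝ → ℝ} (hg : ContinuousOn g (Set.Icc (-1) 1)) (Q : ℝ[X]) :
    ContinuousOn (fun x => Q.eval x * g x) (Set.Icc (-1) 1) :=
  Q.continuous.continuousOn.mul hg

theorem integral_cos_comp_mul_sin {g : ℝ → ℝ} (hg : ContinuousOn g (Set.Icc (-1) 1)) :
    ∫ θ in (0 : ℝ)..Real.pi, g (Real.cos θ) * Real.sin θ = ∫ x in (-1 : ℝ)..1, g x := by
  have h := intervalIntegral.integral_comp_mul_deriv'' (a := 0) (b := Real.pi) (f := Real.cos)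
    (f' := fun θ => -Real.sin θ) (g := g) (by fun_prop)
    (fun θ _ => (Real.hasDerivAt_cos θ).hasDerivWithinAt) (by fun_prop)
    (hg.mono (by rintro _ ⟨θ, -, rfl⟩; exact Real.cos_mem_Icc θ))
  rw [Real.cos_zero, Real.cos_pi, intervalIntegral.integral_symm (-1) 1] at h
  simp only [Function.comp_apply, mul_neg, intervalIntegral.integral_neg, neg_inj] at h
  exact h

/-- The factor `sin θ` in `sin ((n+1)θ) = U_n(cos θ) sin θ` is the Jacobian of `x = cos θ`. This is
why the basis `U_n` appears: the moments are taken with respect to `dx`. -/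
theorem matJ_apply (hw : ContinuousOn w K.carrier) (hw_pos : ∀ x ∈ K.carrier, 0 < w x)
    (N d : ℕ) (l : Fin L) (k : Fin (d + 1)) (n : Fin (N + 1)) :
    matJ K w N d l k n =
      moment (fun x => (Chebyshev.U ℝ (n : ℕ)).eval x / transplant K w l x) k := by
  rw [moment, ← integral_cos_comp_mul_sin (continuousOn_eval_mul (continuousOn_eval_div hw hw_pos l _) _)]
  rw [matJ, Matrix.of_apply]
  refine intervalIntegral.integral_congr fun θ _ => ?_
  have := Chebyshev.U_real_cos θ (n : ℕ)
  simp only [Int.cast_natCast] at this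
  simp only [Chebyshev.T_real_cos, Int.cast_natCast, ← this]
  ring

theorem continuousOn_quotient (hw : ContinuousOn w K.carrier)
    (hw_pos : ∀ x ∈ K.carrier, 0 < w x) (P : ℝ[X]) (l : Fin L) :
    ContinuousOn (quotient K w P l) (Set.Icc (-1) 1) :=
  continuousOn_eval_div hw hw_pos l _

theorem matJ_mulVec (hw : ContinuousOn w K.carrier) (hw_pos : ∀ x ∈ K.carrier, 0 < w x)
    {N : ℕ} (d : ℕ) (l : Fin L) {P : ℝ[X]} (hP : P ∈ degreeLE ℝ N) (k : Fin (d + 1)) :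
    (matJ K w N d l).mulVec ((matW K N l).mulVec (chebCoeffs N P)) k =
      moment (quotient K w P l) k := by
  have h := eq_sum_basisU (K.comp_affine_mem l hP)
  have h1 : ∀ x, (Chebyshev.T ℝ (k : ℕ)).eval x * quotient K w P l x =
      ∑ n : Fin (N + 1), basisU.repr (P.comp (K.affine l)) n *
        ((Chebyshev.T ℝ (k : ℕ)).eval x *
          ((Chebyshev.U ℝ (n : ℕ)).eval x / transplant K w l x)) := fun x => by
    rw [quotient]
    conv_lhs => rw [h]
    simp only [eval_finsetSum, eval_smul, smul_eq_mul, Finset.sum_div, Finset.mul_sum]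
    exact Finset.sum_congr rfl fun n _ => by ring
  rw [moment]
  simp only [h1]
  rw [intervalIntegral.integral_finsetSum fun n _ => (intervalIntegrable_of_continuousOn
    (continuousOn_eval_mul (continuousOn_eval_div hw hw_pos l _) _)).const_mul _]
  simp only [Matrix.mulVec, dotProduct, intervalIntegral.integral_const_mul]
  refine Finset.sum_congr rfl fun n _ => ?_
  rw [matJ_apply hw hw_pos, mul_comm, ← matW_mulVec K l hP]
  rfl

theorem l1Norm_eq (K : IntervalUnion L) (w : ℝ → ℝ) (hw_pos : ∀ x ∈ K.carrier, 0 < w x)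
    (P : ℝ[X]) :
    l1Norm K w P = ∑ l, (K.b l - K.a l) / 2 * ∫ x in (-1 : ℝ)..1, |quotient K w P l x| := by
  refine Finset.sum_congr rfl fun l _ => ?_
  have hc : (K.b l - K.a l) / 2 ≠ 0 := by have := K.lt l; intro h; linarith
  have h := intervalIntegral.integral_comp_mul_add (a := -1) (b := 1)
    (fun t => |P.eval t| / w t) hc ((K.a l + K.b l) / 2)
  rw [show (K.b l - K.a l) / 2 * -1 + (K.a l + K.b l) / 2 = K.a l by ring,
    show (K.b l - K.a l) / 2 * 1 + (K.a l + K.b l) / 2 = K.b l by ring, smul_eq_mul,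
    eq_inv_mul_iff_mul_eq₀ hc] at h
  rw [← h]
  congr 1
  refine intervalIntegral.integral_congr fun x hx => ?_
  rw [Set.uIcc_of_le (by norm_num)] at hx
  simp only [quotient, abs_div, abs_of_pos (transplant_pos hw_pos l hx), eval_comp,
    IntervalUnion.affine, eval_add, eval_mul, eval_C, eval_X]
  rw [transplant]
  congr 2
  ring

end Weight

/-! ### Moments of functions and the dual lower bound -/

/-- At `x = cos θ` the quadratic form has integrand `|∑ v_k e^{ikθ}|² g(x)`, which is nonnegative.
-/
theorem toeplitz_moment_posSemidef (d : ℕ) {g : ℝ → ℝ} (hg : ContinuousOn g (Set.Icc (-1) 1))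
    (hg0 : ∀ x ∈ Set.Icc (-1 : ℝ) 1, 0 ≤ g x) :
    (toeplitz fun k : Fin (d + 1) => moment g k).PosSemidef := by
  rw [toeplitz_posSemidef_iff]
  intro v
  have hi : ∀ i j : Fin (d + 1), IntervalIntegrable (fun x => v i * v j *
      ((Chebyshev.T ℝ (((i : ℕ) - j + ((j : ℕ) - i) : ℕ) : ℤ)).eval x * g x))
      MeasureTheory.volume (-1) 1 := fun i j =>
    (intervalIntegrable_of_continuousOn (continuousOn_eval_mul hg _)).const_mul _
  have h : ∑ i : Fin (d + 1), ∑ j : Fin (d + 1), v i * v j *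
      moment g ((i : ℕ) - j + ((j : ℕ) - i)) =
      ∫ x in (-1 : ℝ)..1, ∑ i : Fin (d + 1), ∑ j : Fin (d + 1), v i * v j *
      ((Chebyshev.T ℝ (((i : ℕ) - j + ((j : ℕ) - i) : ℕ) : ℤ)).eval x * g x) := by
    rw [intervalIntegral.integral_finsetSum]
    swap
    · intro i _
      simpa only [Finset.sum_fn] using IntervalIntegrable.sum Finset.univ fun j _ => hi i j
    refine Finset.sum_congr rfl fun i _ => ?_
    rw [intervalIntegral.integral_finsetSum fun j _ => hi i j]
    exact Finset.sum_congr rfl fun j _ => (intervalIntegral.integral_const_mul _ _).symm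
  rw [h]
  refine intervalIntegral.integral_nonneg (by norm_num) fun x hx => ?_
  obtain ⟨θ, rfl⟩ : ∃ θ, Real.cos θ = x := ⟨Real.arccos x, Real.cos_arccos hx.1 hx.2⟩
  have h2 : ∑ i : Fin (d + 1), ∑ j : Fin (d + 1), v i * v j *
      ((Chebyshev.T ℝ (((i : ℕ) - j + ((j : ℕ) - i) : ℕ) : ℤ)).eval (Real.cos θ) *
        g (Real.cos θ)) =
      ((∑ i : Fin (d + 1), v i * Real.cos ((i : ℕ) * θ)) ^ 2 +
        (∑ i : Fin (d + 1), v i * Real.sin ((i : ℕ) * θ)) ^ 2) * g (Real.cos θ) := by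
    rw [sq, sq, Finset.sum_mul_sum, Finset.sum_mul_sum]
    simp only [eval_T_dist_cos, ← Finset.sum_add_distrib, Finset.sum_mul]
    exact Finset.sum_congr rfl fun i _ => Finset.sum_congr rfl fun j _ => by ring
  rw [h2]
  exact mul_nonneg (by positivity) (hg0 _ hx)

theorem moment_sub {f g : ℝ → ℝ} (hf : ContinuousOn f (Set.Icc (-1) 1))
    (hg : ContinuousOn g (Set.Icc (-1) 1)) (k : ℕ) :
    moment (fun x => f x - g x) k = moment f k - moment g k := by
  simp only [moment, mul_sub]
  exact intervalIntegral.integral_sub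
    (intervalIntegrable_of_continuousOn (continuousOn_eval_mul hf _))
    (intervalIntegrable_of_continuousOn (continuousOn_eval_mul hg _))

theorem moment_zero (g : ℝ → ℝ) : moment g 0 = ∫ x in (-1 : ℝ)..1, g x := by
  simp [moment]

variable {K : IntervalUnion L} {w : ℝ → ℝ}

/-- The `L₁` norm is attained approximately by testing against polynomials. -/
theorem exists_polynomial_lt_integral_mul {h : ℝ → ℝ} (hh : ContinuousOn h (Set.Icc (-1) 1))
    {a : ℝ} (ha : a < ∫ x in (-1 : ℝ)..1, |h x|) :
    ∃ (q : ℝ[X]) (M : ℝ), 0 < M ∧ (∀ x ∈ Set.Icc (-1 : ℝ) 1, |q.eval x| ≤ M) ∧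
      a * M < ∫ x in (-1 : ℝ)..1, q.eval x * h x := by
  set I := ∫ x in (-1 : ℝ)..1, |h x| with hI
  obtain ⟨δ, hδ, hδI⟩ : ∃ δ > 0, a * (1 + δ) < I - 2 * δ - δ * I := by
    have h1 : Tendsto (fun δ : ℝ => I - 2 * δ - δ * I - a * (1 + δ)) (𝓝[>] 0)
        (𝓝 (I - 2 * 0 - 0 * I - a * (1 + 0))) :=
      Tendsto.mono_left (Continuous.tendsto (by fun_prop) 0) nhdsWithin_le_nhds
    have h0 : 0 < I - 2 * 0 - 0 * I - a * (1 + 0) := by linarith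
    obtain ⟨δ, h2, h3⟩ :=
      ((h1.eventually (eventually_gt_nhds h0)).and self_mem_nhdsWithin).exists
    exact ⟨δ, h3, by linarith⟩
  have hpos : ∀ x, 0 < |h x| + δ := fun x => by positivity
  -- `h / (|h| + δ)` is a continuous substitute for the sign of `h`. It is bounded by 1, and its
  -- product with `h` is at least `|h| - δ`; the Weierstrass error costs a further `δ|h|`.
  obtain ⟨q, hq⟩ := exists_polynomial_near_of_continuousOn (-1) 1 (fun x => h x / (|h x| + δ))
    (hh.div (hh.abs.add continuousOn_const) fun x _ => (hpos x).ne') δ hδ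
  refine ⟨q, 1 + δ, by positivity, fun x hx => ?_, hδI.trans_le ?_⟩
  · have h1 : |h x / (|h x| + δ)| ≤ 1 := by
      rw [abs_div, abs_of_pos (hpos x), div_le_one (hpos x)]
      linarith
    have h2 := abs_sub_abs_le_abs_sub (q.eval x) (h x / (|h x| + δ))
    linarith [hq x hx]
  · have hi := intervalIntegrable_of_continuousOn hh.abs
    have h1 : ∫ x in (-1 : ℝ)..1, (|h x| - δ - δ * |h x|) = I - 2 * δ - δ * I := by
      rw [intervalIntegral.integral_sub (hi.sub intervalIntegrable_const) (hi.const_mul δ),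
        intervalIntegral.integral_sub hi intervalIntegrable_const,
        intervalIntegral.integral_const_mul, intervalIntegral.integral_const, ← hI, smul_eq_mul]
      ring
    rw [← h1]
    refine intervalIntegral.integral_mono_on (by norm_num)
      ((hi.sub intervalIntegrable_const).sub (hi.const_mul δ))
      (intervalIntegrable_of_continuousOn (continuousOn_eval_mul hh q)) fun x hx => ?_
    have h2 : |h x| - δ ≤ h x / (|h x| + δ) * h x := by
      rw [div_mul_eq_mul_div, le_div_iff₀ (hpos x)]
      nlinarith [abs_mul_abs_self (h x), sq_nonneg δ]
    have h3 : |(q.eval x - h x / (|h x| + δ)) * h x| ≤ δ * |h x| := by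
      rw [abs_mul]
      exact mul_le_mul_of_nonneg_right (hq x hx).le (abs_nonneg _)
    have h4 := (abs_le.1 h3).1
    linarith

theorem zero_le_of_posSemidef {d : ℕ} {y : Fin (d + 1) → ℝ} (hy : (toeplitz y).PosSemidef) :
    0 ≤ y 0 := by
  have := hy.diag_nonneg (i := 0)
  simpa [toeplitz] using this

theorem basisT_repr_sum {M : Type*} [AddCommMonoid M] {N : ℕ} {P : ℝ[X]}
    (hP : P ∈ degreeLE ℝ N) {f : ℕ → ℝ → M} (hf : ∀ i, f i 0 = 0) :
    (basisT.repr P).sum f = ∑ n : Fin (N + 1), f n (basisT.repr P n) :=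
  sequence_repr_sum (Chebyshev.chebyshevTsequence ℝ) _ hP hf

theorem integral_eval_mul_eq_sum {h : ℝ → ℝ} (hh : ContinuousOn h (Set.Icc (-1) 1)) (q : ℝ[X]) :
    ∫ x in (-1 : ℝ)..1, q.eval x * h x = (basisT.repr q).sum fun k c => c * moment h k := by
  have hq : q ∈ degreeLE ℝ q.natDegree := mem_degreeLE.2 degree_le_natDegree
  rw [basisT_repr_sum hq (f := fun k c => c * moment h k) fun _ => zero_mul _]
  have h1 : ∀ x, q.eval x * h x = ∑ k : Fin (q.natDegree + 1),
      basisT.repr q k * ((Chebyshev.T ℝ (k : ℕ)).eval x * h x) := fun x => by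
    conv_lhs => rw [eq_sum_basisT hq]
    simp only [eval_finsetSum, eval_smul, smul_eq_mul, Finset.sum_mul, mul_assoc]
  simp only [h1]
  rw [intervalIntegral.integral_finsetSum fun k _ =>
    (intervalIntegrable_of_continuousOn (continuousOn_eval_mul hh _)).const_mul _]
  simp only [intervalIntegral.integral_const_mul, moment]

/-- Pair `y⁺ - y⁻` with a test polynomial `q` bounded by `M`. The damped pairing is at most `M * (yp
0 + ym 0)`, and it depends only on the moments of `h`, so it tends to `∫ q h > a * M`, uniformly
over the feasible pairs. -/
theorem eventually_le_of_moments {h : ℝ → ℝ} (hh : ContinuousOn h (Set.Icc (-1) 1)) {a : ℝ}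
    (ha : a < ∫ x in (-1 : ℝ)..1, |h x|) :
    ∀ᶠ d in atTop, ∀ yp ym : Fin (d + 1) → ℝ, (∀ k, yp k - ym k = moment h k) →
      (toeplitz yp).PosSemidef → (toeplitz ym).PosSemidef → a ≤ yp 0 + ym 0 := by
  obtain ⟨q, M, hM, hqM, haM⟩ := exists_polynomial_lt_integral_mul hh ha
  rw [integral_eval_mul_eq_sum hh] at haM
  have hlim : Tendsto (fun d : ℕ => (basisT.repr q).sum fun k c =>
      c * ((1 - (k : ℝ) / (d + 1)) * moment h k)) atTop
      (𝓝 ((basisT.repr q).sum fun k c => c * moment h k)) := by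
    refine tendsto_finsetSum _ fun k _ => ?_
    have h1 : Tendsto (fun d : ℕ => (k : ℝ) / (d + 1)) atTop (𝓝 0) :=
      tendsto_const_nhds.div_atTop
        (tendsto_atTop_add_const_right _ _ tendsto_natCast_atTop_atTop)
    have h2 := ((h1.const_sub 1).mul_const (moment h k)).const_mul (basisT.repr q k)
    simpa using h2
  -- Once `d ≥ deg q`, all coefficients of `q` have index at most `d`.
  filter_upwards [hlim.eventually (eventually_gt_nhds haM), eventually_ge_atTop q.natDegree]
    with d hd hqd yp ym hy hp hm
  have hq : q ∈ degreeLE ℝ d :=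
    mem_degreeLE.2 (degree_le_natDegree.trans (by exact_mod_cast hqd))
  rw [basisT_repr_sum hq (f := fun k c => c * ((1 - (k : ℝ) / (d + 1)) * moment h k))
    fun _ => zero_mul _] at hd
  have hbound : ∀ x ∈ Set.Icc (-1 : ℝ) 1,
      |∑ k : Fin (d + 1), basisT.repr q k * (Chebyshev.T ℝ (k : ℕ)).eval x| ≤ M := fun x hx => by
    have := hqM x hx
    rw [eq_sum_basisT hq] at this
    simpa only [eval_finsetSum, eval_smul, smul_eq_mul] using this
  have h1 := (abs_le.1 (abs_sum_mul_le_of_posSemidef hp _ hbound)).2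
  have h2 := (abs_le.1 (abs_sum_mul_le_of_posSemidef hm _ hbound)).1
  have h3 : ∑ k : Fin (d + 1), basisT.repr q k * ((1 - (k : ℕ) / (d + 1)) * moment h k) =
      ∑ k : Fin (d + 1), basisT.repr q k * ((1 - (k : ℕ) / (d + 1)) * yp k) -
      ∑ k : Fin (d + 1), basisT.repr q k * ((1 - (k : ℕ) / (d + 1)) * ym k) := by
    rw [← Finset.sum_sub_distrib]
    exact Finset.sum_congr rfl fun k _ => by rw [← hy]; ring
  rw [h3] at hd
  refine le_of_mul_le_mul_right ?_ hM
  linarith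

theorem IntervalUnion.half_pos (K : IntervalUnion L) (l : Fin L) : 0 < (K.b l - K.a l) / 2 := by
  have := K.lt l
  linarith

/-! ### The ersatz norms: sublinearity, monotonicity and convergence -/

section Ersatz

variable {N d : ℕ} {P Q : ℝ[X]} {yp ym zp zm : Fin L → Fin (d + 1) → ℝ}

theorem Feasible.objective_nonneg (h : Feasible K w N d P yp ym) : 0 ≤ objective K yp ym :=
  Finset.sum_nonneg fun l _ => mul_nonneg (K.half_pos l).le
    (add_nonneg (zero_le_of_posSemidef (h.psd_pos l)) (zero_le_of_posSemidef (h.psd_neg l)))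

theorem chebCoeffs_add (N : ℕ) (P Q : ℝ[X]) :
    chebCoeffs N (P + Q) = chebCoeffs N P + chebCoeffs N Q := by
  ext n
  simp [chebCoeffs]

theorem chebCoeffs_smul (N : ℕ) (c : ℝ) (P : ℝ[X]) :
    chebCoeffs N (c • P) = c • chebCoeffs N P := by
  ext n
  simp [chebCoeffs]

theorem Feasible.add (h : Feasible K w N d P yp ym) (h' : Feasible K w N d Q zp zm) :
    Feasible K w N d (P + Q) (yp + zp) (ym + zm) where
  moments l := by
    rw [chebCoeffs_add, Matrix.mulVec_add, Matrix.mulVec_add, ← h.moments, ← h'.moments]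
    simp only [Pi.add_apply]
    abel
  psd_pos l := (h.psd_pos l).add (h'.psd_pos l)
  psd_neg l := (h.psd_neg l).add (h'.psd_neg l)

theorem Feasible.smul (h : Feasible K w N d P yp ym) {c : ℝ} (hc : 0 ≤ c) :
    Feasible K w N d (c • P) (c • yp) (c • ym) where
  moments l := by
    rw [chebCoeffs_smul, Matrix.mulVec_smul, Matrix.mulVec_smul, ← h.moments]
    simp only [Pi.smul_apply, smul_sub]
  psd_pos l := (h.psd_pos l).smul hc
  psd_neg l := (h.psd_neg l).smul hc

theorem objective_add : objective K (yp + zp) (ym + zm) = objective K yp ym + objective K zp zm := by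
  simp only [objective, ← Finset.sum_add_distrib, Pi.add_apply]
  exact Finset.sum_congr rfl fun l _ => by ring

theorem objective_smul (c : ℝ) : objective K (c • yp) (c • ym) = c * objective K yp ym := by
  simp only [objective, Finset.mul_sum, Pi.smul_apply, smul_eq_mul]
  exact Finset.sum_congr rfl fun l _ => by ring

/-- Truncating the moment sequences. -/
theorem Feasible.castSucc {yp ym : Fin L → Fin (d + 2) → ℝ} (h : Feasible K w N (d + 1) P yp ym) :
    Feasible K w N d P (fun l k => yp l k.castSucc) (fun l k => ym l k.castSucc) where
  moments l := by
    ext k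
    exact congrFun (h.moments l) k.castSucc
  psd_pos l := (h.psd_pos l).submatrix Fin.castSucc
  psd_neg l := (h.psd_neg l).submatrix Fin.castSucc

theorem Feasible.ersatzNorm_le (h : Feasible K w N d P yp ym) :
    ersatzNorm K w N d P ≤ objective K yp ym :=
  csInf_le ⟨0, by rintro _ ⟨_, _, h, rfl⟩; exact h.objective_nonneg⟩ ⟨_, _, h, rfl⟩

theorem ersatzNorm_nonneg : 0 ≤ ersatzNorm K w N d P :=
  Real.sInf_nonneg (by rintro _ ⟨_, _, h, rfl⟩; exact h.objective_nonneg)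

/-- The moments of the positive and negative parts of `P / w` are feasible. -/
theorem exists_feasible (hw : ContinuousOn w K.carrier) (hw_pos : ∀ x ∈ K.carrier, 0 < w x)
    (d : ℕ) (hP : P ∈ degreeLE ℝ N) :
    ∃ yp ym : Fin L → Fin (d + 1) → ℝ, Feasible K w N d P yp ym ∧
      objective K yp ym = l1Norm K w P := by
  have hq := continuousOn_quotient hw hw_pos P
  have hp : ∀ l, ContinuousOn (fun x => max (quotient K w P l x) 0) (Set.Icc (-1) 1) :=
    fun l => (hq l).sup continuousOn_const
  have hm : ∀ l, ContinuousOn (fun x => max (-quotient K w P l x) 0) (Set.Icc (-1) 1) :=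
    fun l => (hq l).neg.sup continuousOn_const
  refine ⟨fun l k => moment (fun x => max (quotient K w P l x) 0) k,
    fun l k => moment (fun x => max (-quotient K w P l x) 0) k, ⟨fun l => ?_, fun l => ?_,
    fun l => ?_⟩, ?_⟩
  · ext k
    rw [matJ_mulVec hw hw_pos d l hP, Pi.sub_apply, ← moment_sub (hp l) (hm l)]
    congr 1
    ext x
    exact max_zero_sub_max_neg_zero_eq_self _
  · exact toeplitz_moment_posSemidef d (hp l) fun x _ => le_max_right _ _
  · exact toeplitz_moment_posSemidef d (hm l) fun x _ => le_max_right _ _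
  · rw [l1Norm_eq K w hw_pos]
    refine Finset.sum_congr rfl fun l _ => ?_
    simp only [Fin.val_zero, moment_zero]
    rw [← intervalIntegral.integral_add (intervalIntegrable_of_continuousOn (hp l))
      (intervalIntegrable_of_continuousOn (hm l))]
    congr 2
    ext x
    exact max_zero_add_max_neg_zero_eq_abs_self _

theorem ersatzNorm_le_l1Norm (hw : ContinuousOn w K.carrier) (hw_pos : ∀ x ∈ K.carrier, 0 < w x)
    (d : ℕ) (hP : P ∈ degreeLE ℝ N) : ersatzNorm K w N d P ≤ l1Norm K w P := by
  obtain ⟨yp, ym, h, ho⟩ := exists_feasible hw hw_pos d hP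
  exact ho ▸ h.ersatzNorm_le

/-- A real `sInf` over the empty set is 0, so lower bounds require a feasible point;
`exists_feasible` supplies it. -/
theorem le_ersatzNorm (hw : ContinuousOn w K.carrier) (hw_pos : ∀ x ∈ K.carrier, 0 < w x)
    (hP : P ∈ degreeLE ℝ N) {a : ℝ}
    (h : ∀ yp ym : Fin L → Fin (d + 1) → ℝ, Feasible K w N d P yp ym → a ≤ objective K yp ym) :
    a ≤ ersatzNorm K w N d P := by
  obtain ⟨yp, ym, hf, -⟩ := exists_feasible hw hw_pos d hP
  exact le_csInf ⟨_, yp, ym, hf, rfl⟩ (by rintro _ ⟨_, _, hf, rfl⟩; exact h _ _ hf)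

theorem ersatzNorm_le_succ (hw : ContinuousOn w K.carrier) (hw_pos : ∀ x ∈ K.carrier, 0 < w x)
    (hP : P ∈ degreeLE ℝ N) : ersatzNorm K w N d P ≤ ersatzNorm K w N (d + 1) P :=
  le_ersatzNorm hw hw_pos hP fun _ _ h => h.castSucc.ersatzNorm_le

theorem ersatzNorm_add_le (hw : ContinuousOn w K.carrier) (hw_pos : ∀ x ∈ K.carrier, 0 < w x)
    (hP : P ∈ degreeLE ℝ N) (hQ : Q ∈ degreeLE ℝ N) :
    ersatzNorm K w N d (P + Q) ≤ ersatzNorm K w N d P + ersatzNorm K w N d Q := by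
  rw [← sub_le_iff_le_add]
  refine le_ersatzNorm hw hw_pos hP fun yp ym h => ?_
  rw [sub_le_comm]
  refine le_ersatzNorm hw hw_pos hQ fun zp zm h' => ?_
  rw [sub_le_iff_le_add', ← objective_add]
  exact (h.add h').ersatzNorm_le

theorem ersatzNorm_smul_le (hw : ContinuousOn w K.carrier) (hw_pos : ∀ x ∈ K.carrier, 0 < w x)
    (hP : P ∈ degreeLE ℝ N) {c : ℝ} (hc : 0 < c) :
    ersatzNorm K w N d (c • P) ≤ c * ersatzNorm K w N d P := by
  rw [mul_comm, ← div_le_iff₀ hc]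
  refine le_ersatzNorm hw hw_pos hP fun yp ym h => ?_
  rw [div_le_iff₀ hc, mul_comm, ← objective_smul]
  exact (h.smul hc.le).ersatzNorm_le

theorem tendsto_ersatzNorm (hw : ContinuousOn w K.carrier) (hw_pos : ∀ x ∈ K.carrier, 0 < w x)
    (hP : P ∈ degreeLE ℝ N) :
    Tendsto (fun d => ersatzNorm K w N d P) atTop (𝓝 (l1Norm K w P)) := by
  refine tendsto_order.2 ⟨fun a ha => ?_, fun a ha =>
    Eventually.of_forall fun d => (ersatzNorm_le_l1Norm hw hw_pos d hP).trans_lt ha⟩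
  set S := ∑ l, (K.b l - K.a l) / 2
  have hS : 0 ≤ S := Finset.sum_nonneg fun l _ => (K.half_pos l).le
  -- The loss `ε` on each interval adds up to `ε * S` after weighting by half-lengths; the `+ 1`
  -- makes this strictly less than the gap.
  set ε := (l1Norm K w P - a) / (S + 1)
  have hε : 0 < ε := div_pos (sub_pos.2 ha) (by linarith)
  have hεS : ε * S < l1Norm K w P - a := by
    have : ε * (S + 1) = l1Norm K w P - a := div_mul_cancel₀ _ (by linarith)
    linarith
  have hev : ∀ l, ∀ᶠ d in atTop, ∀ yp ym : Fin (d + 1) → ℝ,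
      (∀ k, yp k - ym k = moment (quotient K w P l) k) → (toeplitz yp).PosSemidef →
      (toeplitz ym).PosSemidef → (∫ x in (-1 : ℝ)..1, |quotient K w P l x|) - ε ≤ yp 0 + ym 0 :=
    fun l => eventually_le_of_moments (continuousOn_quotient hw hw_pos P l) (by linarith)
  filter_upwards [eventually_all.2 hev] with d hd
  refine lt_of_lt_of_le (b := l1Norm K w P - ε * S) (by linarith)
    (le_ersatzNorm hw hw_pos hP fun yp ym h => ?_)
  rw [l1Norm_eq K w hw_pos, Finset.mul_sum, ← Finset.sum_sub_distrib]
  refine Finset.sum_le_sum fun l _ => ?_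
  rw [mul_comm ε, ← mul_sub]
  refine mul_le_mul_of_nonneg_left (hd l _ _ (fun k => ?_) (h.psd_pos l) (h.psd_neg l))
    (K.half_pos l).le
  rw [← matJ_mulVec hw hw_pos d l hP, ← h.moments]
  rfl

end Ersatz

/-! ### The weighted L₁ norm on polynomials, and the monic constraint -/

theorem quotient_add (P Q : ℝ[X]) (l : Fin L) (x : ℝ) :
    quotient K w (P + Q) l x = quotient K w P l x + quotient K w Q l x := by
  simp only [quotient, add_comp, eval_add, add_div]

theorem quotient_smul (c : ℝ) (P : ℝ[X]) (l : Fin L) (x : ℝ) :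
    quotient K w (c • P) l x = c * quotient K w P l x := by
  simp only [quotient, smul_comp, eval_smul, smul_eq_mul, mul_div_assoc]

theorem l1Norm_nonneg (hw_pos : ∀ x ∈ K.carrier, 0 < w x) (P : ℝ[X]) : 0 ≤ l1Norm K w P := by
  rw [l1Norm_eq K w hw_pos]
  exact Finset.sum_nonneg fun l _ => mul_nonneg (K.half_pos l).le
    (intervalIntegral.integral_nonneg (by norm_num) fun x _ => abs_nonneg _)

theorem l1Norm_add_le (hw : ContinuousOn w K.carrier) (hw_pos : ∀ x ∈ K.carrier, 0 < w x)
    (P Q : ℝ[X]) : l1Norm K w (P + Q) ≤ l1Norm K w P + l1Norm K w Q := by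
  have hi : ∀ (P : ℝ[X]) (l : Fin L), IntervalIntegrable (fun x => |quotient K w P l x|)
      MeasureTheory.volume (-1) 1 := fun P l =>
    intervalIntegrable_of_continuousOn (continuousOn_quotient hw hw_pos P l).abs
  simp only [l1Norm_eq K w hw_pos, ← Finset.sum_add_distrib, ← mul_add]
  refine Finset.sum_le_sum fun l _ => mul_le_mul_of_nonneg_left ?_ (K.half_pos l).le
  rw [← intervalIntegral.integral_add (hi P l) (hi Q l)]
  refine intervalIntegral.integral_mono_on (by norm_num) (hi _ l) ((hi P l).add (hi Q l))
    fun x _ => ?_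
  rw [quotient_add]
  exact abs_add_le _ _

theorem l1Norm_smul (hw_pos : ∀ x ∈ K.carrier, 0 < w x) (c : ℝ) (P : ℝ[X]) :
    l1Norm K w (c • P) = |c| * l1Norm K w P := by
  simp only [l1Norm_eq K w hw_pos, quotient_smul, abs_mul, intervalIntegral.integral_const_mul,
    Finset.mul_sum]
  exact Finset.sum_congr rfl fun l _ => mul_left_comm _ _ _

theorem eq_zero_of_l1Norm_eq_zero (hw : ContinuousOn w K.carrier)
    (hw_pos : ∀ x ∈ K.carrier, 0 < w x) {P : ℝ[X]} (h : l1Norm K w P = 0) : P = 0 := by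
  -- Vanishing on a single interval already gives infinitely many roots.
  set l : Fin L := ⟨0, K.pos⟩
  have hc := continuousOn_quotient hw hw_pos P l
  rw [l1Norm_eq K w hw_pos, Finset.sum_eq_zero_iff_of_nonneg fun l _ =>
    mul_nonneg (K.half_pos l).le
      (intervalIntegral.integral_nonneg (by norm_num) fun x _ => abs_nonneg _)] at h
  have h1 := (mul_eq_zero.1 (h l (Finset.mem_univ _))).resolve_left (K.half_pos l).ne'
  have h2 : ∀ x ∈ Set.Icc (-1 : ℝ) 1, (P.comp (K.affine l)).eval x = 0 := fun x hx => by
    by_contra hne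
    refine (intervalIntegral.integral_pos (by norm_num) hc.abs (fun x _ => abs_nonneg _)
      ⟨x, hx, abs_pos.2 (div_ne_zero hne (transplant_pos hw_pos l hx).ne')⟩).ne' h1
  have h3 : P.comp (K.affine l) = 0 :=
    Polynomial.eq_zero_of_infinite_isRoot _ ((Set.Icc_infinite (by norm_num)).mono h2)
  refine Polynomial.eq_zero_of_infinite_isRoot _
    (((Set.Icc_infinite (show (-1 : ℝ) < 1 by norm_num)).image
      (f := fun x => (K.b l - K.a l) / 2 * x + (K.a l + K.b l) / 2) ?_).mono ?_)
  · intro x _ y _ hxy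
    exact mul_left_cancel₀ (K.half_pos l).ne' (add_right_cancel hxy)
  · rintro _ ⟨x, hx, rfl⟩
    have := h2 x hx
    simpa [IntervalUnion.affine, eval_comp] using this

/-- Inside `degreeLE ℝ N` the monic constraint becomes one affine equation, hence defines a closed
set. -/
theorem monic_and_natDegree_eq_iff {N : ℕ} {P : ℝ[X]} (hP : P ∈ degreeLE ℝ N) :
    (P.Monic ∧ P.natDegree = N) ↔ P.coeff N = 1 := by
  constructor
  · rintro ⟨h, rfl⟩
    exact h
  · intro h
    have h1 : P.natDegree ≤ N := natDegree_le_iff_degree_le.2 (mem_degreeLE.1 hP)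
    have h2 : P.natDegree = N :=
      le_antisymm h1 (le_natDegree_of_ne_zero (by rw [h]; exact one_ne_zero))
    exact ⟨monic_of_natDegree_le_of_coeff_eq_one N h1 h, h2⟩

theorem isMonicMinimizer_iff {N : ℕ} {F : ℝ[X] → ℝ} {P : degreeLE ℝ N} :
    IsMonicMinimizer N F P ↔ P ∈ {P : degreeLE ℝ N | (P : ℝ[X]).coeff N = 1} ∧
      ∀ Q ∈ {P : degreeLE ℝ N | (P : ℝ[X]).coeff N = 1}, F P ≤ F Q := by
  rw [IsMonicMinimizer, monic_and_natDegree_eq_iff P.2]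
  refine and_congr_right fun _ => ⟨fun h Q hQ => ?_, fun h Q h1 h2 => ?_⟩
  · obtain ⟨h1, h2⟩ := (monic_and_natDegree_eq_iff Q.2).2 hQ
    exact h Q h1 h2
  · have hQ : Q ∈ degreeLE ℝ N := mem_degreeLE.2 (natDegree_le_iff_degree_le.1 h2.le)
    exact h ⟨Q, hQ⟩ ((monic_and_natDegree_eq_iff hQ).1 ⟨h1, h2⟩)

theorem finiteDimensional_degreeLE (N : ℕ) : FiniteDimensional ℝ (degreeLE ℝ N) := by
  rw [← degreeLT_succ_eq_degreeLE]
  exact Module.Finite.equiv (degreeLTEquiv ℝ (N + 1)).symm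

/-- The weighted `L₁` norm makes the space of polynomials of degree at most `N` a normed space. -/
theorem l1Norm_core (hw : ContinuousOn w K.carrier) (hw_pos : ∀ x ∈ K.carrier, 0 < w x) (N : ℕ) :
    @NormedSpace.Core ℝ (degreeLE ℝ N) _ _ _ ⟨fun P => l1Norm K w P⟩ :=
  let : Norm (degreeLE ℝ N) := ⟨fun P => l1Norm K w P⟩
  { norm_nonneg := fun P => l1Norm_nonneg hw_pos P
    norm_smul := fun c P => l1Norm_smul hw_pos c P
    norm_triangle := fun P Q => l1Norm_add_le hw hw_pos P Q
    norm_eq_zero_iff := fun P => by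
      refine ⟨fun h => Subtype.ext (eq_zero_of_l1Norm_eq_zero hw hw_pos h), fun h => ?_⟩
      have := l1Norm_smul hw_pos 0 (0 : ℝ[X])
      rw [h]
      simpa using this }

end ErsatzChebyshev

end

/-! ### The main theorem -/

theorem mainTheorem1 {L : ℕ} (K : ErsatzChebyshev.IntervalUnion L) (w : ℝ → ℝ)
    (hw : ContinuousOn w K.carrier) (hw_pos : ∀ x ∈ K.carrier, 0 < w x) (N : ℕ)
    (V : ℕ → degreeLE ℝ N)
    (hV : ∀ d, N ≤ d →
      ErsatzChebyshev.IsMonicMinimizer N (ErsatzChebyshev.ersatzNorm K w N d) (V d)) :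
    (∃ φ : ℕ → ℕ, StrictMono φ ∧ (∀ m, N ≤ φ m) ∧
      ∃ U : degreeLE ℝ N,
        ErsatzChebyshev.IsMonicMinimizer N (ErsatzChebyshev.l1Norm K w) U ∧
        ErsatzChebyshev.ConvergesTo (V ∘ φ) U) ∧
    (∀ d, N ≤ d → ErsatzChebyshev.ersatzNorm K w N d (V d) ≤
      ErsatzChebyshev.ersatzNorm K w N (d + 1) (V (d + 1))) ∧
    (∀ U : degreeLE ℝ N, ErsatzChebyshev.IsMonicMinimizer N (ErsatzChebyshev.l1Norm K w) U →
      (∀ d, N ≤ d →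
        ErsatzChebyshev.ersatzNorm K w N d (V d) ≤ ErsatzChebyshev.l1Norm K w U) ∧
      Tendsto (fun d => ErsatzChebyshev.ersatzNorm K w N d (V d)) atTop
        (𝓝 (ErsatzChebyshev.l1Norm K w U))) ∧
    (∀ U : degreeLE ℝ N, ErsatzChebyshev.IsMonicMinimizer N (ErsatzChebyshev.l1Norm K w) U →
      (∀ U' : degreeLE ℝ N,
        ErsatzChebyshev.IsMonicMinimizer N (ErsatzChebyshev.l1Norm K w) U' → U' = U) →
      ErsatzChebyshev.ConvergesTo V U) := by
  open ErsatzChebyshev in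
  -- The space carries the weighted L₁ norm itself, so that `‖P‖` is the limit of the ersatz norms.
  let : Norm (degreeLE ℝ N) := ⟨fun P => l1Norm K w P⟩
  have core : NormedSpace.Core ℝ (degreeLE ℝ N) := l1Norm_core hw hw_pos N
  let : NormedAddCommGroup (degreeLE ℝ N) := NormedAddCommGroup.ofCore core
  let : NormedSpace ℝ (degreeLE ℝ N) := NormedSpace.ofCore core
  have := finiteDimensional_degreeLE N
  have hE : ApproximatesNorm fun d (P : degreeLE ℝ N) => ersatzNorm K w N d P :=
    { nonneg := fun d P => ersatzNorm_nonneg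
      add_le := fun d P Q => ersatzNorm_add_le hw hw_pos P.2 Q.2
      smul_le := fun d c P hc => ersatzNorm_smul_le hw hw_pos P.2 hc
      le_norm := fun d P => ersatzNorm_le_l1Norm hw hw_pos d P.2
      mono := fun P => monotone_nat_of_le_succ fun d => ersatzNorm_le_succ hw hw_pos P.2
      tendsto := fun P => tendsto_ersatzNorm hw hw_pos P.2 }
  have hA : IsClosed {P : degreeLE ℝ N | (P : ℝ[X]).coeff N = 1} :=
    isClosed_eq (LinearMap.continuous_of_finiteDimensional
      ((lcoeff ℝ N).comp (degreeLE ℝ N).subtype)) continuous_const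
  simp only [isMonicMinimizer_iff] at hV ⊢
  refine ⟨?_, fun d hd => hE.le_succ hV hd, fun U hU => ⟨fun d hd => ?_,
    hE.tendsto_min hV hU.1 hU.2⟩, fun U _ huniq ν _ => ?_⟩
  · obtain ⟨U, hU, hmin, φ, hφ, hlim⟩ :=
      -- The shift `m ↦ m + N` keeps the extracted indices at least `N`.
      hE.exists_subseq_tendsto hA hV (tendsto_add_atTop_nat N)
    exact ⟨fun m => φ m + N, fun _ _ h => Nat.add_lt_add_right (hφ h) N,
      fun m => Nat.le_add_left _ _, U, ⟨hU, hmin⟩, fun ν _ => tendsto_seminorm_sub ν hlim⟩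
  · exact ((hV d hd).2 U hU.1).trans (hE.le_norm d U)
  · exact tendsto_seminorm_sub ν
      (hE.tendsto_of_unique hA hV fun U' h1 h2 => huniq U' ⟨h1, h2⟩)
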